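/- Let $K$ be a field, let $n\ge m\ge 3$ be integers, and let $P\subset K[x_1,\dots,x_n]$ be a monomial prime, that is, a prime ideal generated by monomials. An $m$-hypergraph of size $n$ is a hypergraph $H$ with vertex set $\{x_1,\dots,x_n\}$ whose edges are subsets consisting of exactly $m$ distinct vertices. The Alexander dual of its edge ideal $I(H)$ is the ideal $$I(H)^\vee=\bigcap_{\{x_{i_1},\dots,x_{i_m}\}\in E(H)}(x_{i_1},\dots,x_{i_m})\subseteq K[x_1,\dots,x_n],$$ where $E(H)$ is the edge set of $H$ (an empty intersection is the whole ring). Then $P$ is an associated prime of $(I(H)^\vee)^2$ (that is, of the module $K[x_1,\dots,x_n]/(I(H)^\vee)^2$) for some $m$-hypergraph $H$ of size $n$ if and only if $\operatorname{height}(P)\ge m$. -/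

import Mathlib

open MvPolynomial

/-- `H` is an `m`-hypergraph of size `n`: its vertex set consists of all of the `n` vertices
`x_0, …, x_{n-1}` (indexed by `Fin n`), and each edge is a set of exactly `m` distinct vertices. -/
def IsMHypergraph {n : ℕ} (m : ℕ) (H : Hypergraph (Fin n)) : Prop :=
  H.vertexSet = Set.univ ∧ ∀ e ∈ H.edgeSet, e.ncard = m

/-- The Alexander dual `I(H)^∨` of the edge ideal of `H`: the intersection, over the edges
`{x_{i_1}, …, x_{i_m}}` of `H`, of the ideals `(x_{i_1}, …, x_{i_m})` of `K[x_0, …, x_{n-1}]`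
(the whole ring if there are no edges). -/
noncomputable def alexanderDual (K : Type*) [Field K] {n : ℕ} (H : Hypergraph (Fin n)) :
    Ideal (MvPolynomial (Fin n) K) :=
  ⨅ e ∈ H.edgeSet, Ideal.span ((X : Fin n → MvPolynomial (Fin n) K) '' e)

/-- A monomial prime: a prime ideal of `K[x_0, …, x_{n-1}]` generated by a set of monomials. -/
def IsMonomialPrime {K : Type*} [Field K] {n : ℕ} (P : Ideal (MvPolynomial (Fin n) K)) : Prop :=
  P.IsPrime ∧ ∃ S : Set (Fin n →₀ ℕ), P = Ideal.span ((fun s => monomial s (1 : K)) '' S)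

/-- The support of the exponent vector `s` is a vertex cover of `H`. -/
def IsCoverExponent {n : ℕ} (H : Hypergraph (Fin n)) (s : Fin n →₀ ℕ) : Prop :=
  ∀ e ∈ H.edgeSet, ∃ i ∈ e, s i ≠ 0

section VariableIdeals

variable {σ K : Type*} [Field K]

theorem isPrime_span_X_image (T : Set σ) :
    (Ideal.span ((X : σ → MvPolynomial σ K) '' T)).IsPrime := by
  classical
  let φ : MvPolynomial σ K →ₐ[K] MvPolynomial σ K := aeval fun i => if i ∈ T then 0 else X i
  have hsub : ∀ f, f - φ f ∈ Ideal.span ((X : σ → MvPolynomial σ K) '' T) := by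
    intro f
    induction f using MvPolynomial.induction_on with
    | C a => simp [φ, algebraMap_eq]
    | add p q hp hq =>
      rw [map_add, add_sub_add_comm]
      exact add_mem hp hq
    | mul_X p i hp =>
      have h : p * X i - φ (p * X i) = (p - φ p) * X i + φ p * (X i - φ (X i)) := by
        rw [map_mul]; ring
      rw [h]
      refine add_mem (Ideal.mul_mem_right _ _ hp) (Ideal.mul_mem_left _ _ ?_)
      by_cases hi : i ∈ T
      · simpa [φ, hi] using Ideal.subset_span (Set.mem_image_of_mem X hi)
      · simp [φ, hi]
  have hker : Ideal.span ((X : σ → MvPolynomial σ K) '' T) = RingHom.ker φ := by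
    refine le_antisymm (Ideal.span_le.2 ?_) fun f hf => ?_
    · rintro _ ⟨i, hi, rfl⟩
      simp [φ, RingHom.mem_ker, hi]
    · have := hsub f
      rwa [RingHom.mem_ker.1 hf, sub_zero] at this
  rw [hker]
  exact RingHom.ker_isPrime φ

theorem X_mem_span_X_image {T : Set σ} {i : σ} :
    (X i : MvPolynomial σ K) ∈ Ideal.span (X '' T) ↔ i ∈ T := by
  classical
  rw [mem_ideal_span_X_image]
  refine ⟨fun h => ?_, fun h => ?_⟩
  · obtain ⟨j, hj, hji⟩ := h (Finsupp.single i 1) (by simp [support_X])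
    by_cases hij : i = j
    · exact hij ▸ hj
    · simp [hij] at hji
  · intro s hs
    rw [support_X, Finset.mem_singleton] at hs
    exact ⟨i, h, by simp [hs]⟩

theorem card_le_height_span_X_image (T : Finset σ) :
    (T.card : ℕ∞) ≤ (Ideal.span ((X : σ → MvPolynomial σ K) '' T)).height := by
  classical
  induction T using Finset.induction_on with
  | empty => simp
  | insert a T ha ih =>
    have h1 := isPrime_span_X_image (K := K) (T : Set σ)
    have h2 := isPrime_span_X_image (K := K) ((insert a T : Finset σ) : Set σ)
    have hlt : Ideal.span ((X : σ → MvPolynomial σ K) '' (T : Set σ)) <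
        Ideal.span (X '' ((insert a T : Finset σ) : Set σ)) := by
      refine lt_of_le_of_ne (Ideal.span_mono (Set.image_mono (by simp))) fun h => ha ?_
      have : (X a : MvPolynomial σ K) ∈
          Ideal.span (X '' ((insert a T : Finset σ) : Set σ)) :=
        X_mem_span_X_image.2 (by simp)
      rw [← h] at this
      exact Finset.mem_coe.1 (X_mem_span_X_image.1 this)
    rw [Finset.card_insert_of_notMem ha, Nat.cast_succ]
    exact (add_le_add_left ih 1).trans (Ideal.height_add_one_le_of_lt_of_isPrime hlt)

theorem height_span_X_image_le [Finite σ] (T : Finset σ) :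
    (Ideal.span ((X : σ → MvPolynomial σ K) '' T)).height ≤ T.card := by
  classical
  have h1 := isPrime_span_X_image (K := K) (T : Set σ)
  refine (Ideal.height_le_card_of_mem_minimalPrimes_span_finset (s := T.image X) ?_).trans
    (by exact_mod_cast Finset.card_image_le)
  rw [Finset.coe_image, Ideal.minimalPrimes_eq_subsingleton_self]
  exact rfl

theorem eq_span_X_image_of_eq_span_monomial {P : Ideal (MvPolynomial σ K)} (hP : P.IsPrime)
    {S : Set (σ →₀ ℕ)} (hS : P = Ideal.span ((fun s => monomial s (1 : K)) '' S)) :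
    P = Ideal.span (X '' {i | X i ∈ P}) := by
  classical
  refine le_antisymm ?_ (Ideal.span_le.2 ?_)
  · conv_lhs => rw [hS]
    refine Ideal.span_le.2 ?_
    rintro _ ⟨s, hs, rfl⟩
    have hmem : monomial s (1 : K) ∈ P := hS ▸ Ideal.subset_span ⟨s, hs, rfl⟩
    have hmem' := hmem
    rw [monomial_eq, C_1, one_mul, Finsupp.prod, hP.prod_mem_iff] at hmem
    obtain ⟨i, hi, hiP⟩ := hmem
    refine mem_ideal_span_X_image.2 fun t ht => ?_
    have : t = s := by
      have := support_monomial_subset ht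
      simpa using this
    exact ⟨i, hP.mem_of_pow_mem _ hiP, this ▸ Finsupp.mem_support_iff.1 hi⟩
  · rintro _ ⟨i, hi, rfl⟩
    exact hi

end VariableIdeals

section AlexanderDual

variable {K : Type*} [Field K] {n : ℕ} {H : Hypergraph (Fin n)}

theorem mem_alexanderDual_iff {f : MvPolynomial (Fin n) K} :
    f ∈ alexanderDual K H ↔ ∀ s ∈ f.support, IsCoverExponent H s := by
  simp only [alexanderDual, Submodule.mem_iInf, mem_ideal_span_X_image, IsCoverExponent]
  exact ⟨fun h s hs e he => h e he s hs, fun h e he s hs => h s hs e he⟩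

theorem alexanderDual_eq_span :
    alexanderDual K H =
      Ideal.span ((fun s => monomial s (1 : K)) '' {s | IsCoverExponent H s}) := by
  ext f
  rw [mem_alexanderDual_iff, mem_ideal_span_monomial_image]
  refine forall₂_congr fun s _ => ⟨fun h => ⟨s, h, le_rfl⟩, ?_⟩
  rintro ⟨t, ht, hts⟩ e he
  obtain ⟨i, hi, h0⟩ := ht e he
  exact ⟨i, hi, fun h => h0 (Nat.le_zero.1 (h ▸ hts i))⟩

theorem mem_alexanderDual_sq_iff {f : MvPolynomial (Fin n) K} :
    f ∈ alexanderDual K H ^ 2 ↔ ∀ u ∈ f.support,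
      ∃ s t, IsCoverExponent H s ∧ IsCoverExponent H t ∧ s + t ≤ u := by
  have h : alexanderDual K H ^ 2 = Ideal.span ((fun s => monomial s (1 : K)) ''
      {u | ∃ s t, IsCoverExponent H s ∧ IsCoverExponent H t ∧ s + t = u}) := by
    rw [sq, alexanderDual_eq_span, Ideal.span_mul_span']
    congr 1
    ext g
    simp only [Set.mem_mul, Set.mem_image, Set.mem_ofPred_eq]
    constructor
    · rintro ⟨_, ⟨s, hs, rfl⟩, _, ⟨t, ht, rfl⟩, rfl⟩
      exact ⟨s + t, ⟨s, t, hs, ht, rfl⟩, by simp [monomial_mul]⟩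
    · rintro ⟨_, ⟨s, t, hs, ht, rfl⟩, rfl⟩
      exact ⟨_, ⟨s, hs, rfl⟩, _, ⟨t, ht, rfl⟩, by simp [monomial_mul]⟩
  rw [h, mem_ideal_span_monomial_image]
  refine forall₂_congr fun u _ => ⟨?_, ?_⟩
  · rintro ⟨_, ⟨s, t, hs, ht, rfl⟩, hu⟩
    exact ⟨s, t, hs, ht, hu⟩
  · rintro ⟨s, t, hs, ht, hu⟩
    exact ⟨_, ⟨s, t, hs, ht, rfl⟩, hu⟩

theorem exists_edge_of_alexanderDual_le {P : Ideal (MvPolynomial (Fin n) K)} (hP : P.IsPrime)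
    (h : alexanderDual K H ≤ P) : ∃ e ∈ H.edgeSet, Ideal.span (X '' e) ≤ P := by
  classical
  by_contra! hne
  have hmem : ∏ i with (X i : MvPolynomial (Fin n) K) ∉ P, (X i : MvPolynomial (Fin n) K) ∈ P := by
    apply h
    simp only [alexanderDual, Submodule.mem_iInf]
    intro e he
    obtain ⟨i, hi, hiP⟩ : ∃ i ∈ e, (X i : MvPolynomial (Fin n) K) ∉ P := by
      by_contra! hall
      refine hne e he (Ideal.span_le.2 ?_)
      rintro _ ⟨i, hi, rfl⟩
      exact hall i hi
    exact Ideal.mem_of_dvd _ (Finset.dvd_prod_of_mem _ (by simpa using hiP))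
      (Ideal.subset_span (Set.mem_image_of_mem X hi))
  obtain ⟨i, hi, hiP⟩ := (hP.prod_mem_iff).1 hmem
  exact (Finset.mem_filter.1 hi).2 hiP

theorem alexanderDual_le_of_mem_associatedPrimes {P : Ideal (MvPolynomial (Fin n) K)}
    (h : P ∈ associatedPrimes (MvPolynomial (Fin n) K)
      (MvPolynomial (Fin n) K ⧸ alexanderDual K H ^ 2)) : alexanderDual K H ≤ P := by
  obtain ⟨hP, x, hx⟩ := h
  obtain ⟨f, rfl⟩ := Ideal.Quotient.mk_surjective x
  intro g hg
  refine hP.mem_of_pow_mem 2 ?_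
  rw [hx]
  refine Ideal.le_radical (Submodule.mem_colon_singleton.2 ?_)
  rw [Submodule.mem_bot, Algebra.smul_def, Ideal.Quotient.algebraMap_eq, ← map_mul,
    Ideal.Quotient.eq_zero_iff_mem]
  exact Ideal.mul_mem_right _ _ (Ideal.pow_mem_pow hg 2)

/-- If no two covers are disjoint inside `A ⊆ W`, but adding to `A` a further copy of any vertex of
`W` creates two such covers, then the variables in `W` generate an associated prime. -/
theorem span_X_image_mem_associatedPrimes {W A : Finset (Fin n)} (hAW : A ⊆ W)
    (hHW : ∀ e ∈ H.edgeSet, e ⊆ W)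
    (hdisj : ∀ C D : Set (Fin n), (∀ e ∈ H.edgeSet, ∃ i ∈ e, i ∈ A ∧ i ∈ C) →
      (∀ e ∈ H.edgeSet, ∃ i ∈ e, i ∈ A ∧ i ∈ D) → ∃ i ∈ A, i ∈ C ∧ i ∈ D)
    (hcover : ∀ w ∈ W, ∃ C ⊆ A, (∀ e ∈ H.edgeSet, ∃ i ∈ e, i ∈ C) ∧
      ∀ e ∈ H.edgeSet, ∃ i ∈ e, i ∈ A \ C ∨ i = w) :
    Ideal.span (X '' W) ∈ associatedPrimes (MvPolynomial (Fin n) K)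
      (MvPolynomial (Fin n) K ⧸ alexanderDual K H ^ 2) := by
  classical
  have hprime := isPrime_span_X_image (K := K) (W : Set (Fin n))
  let a : Fin n →₀ ℕ := Finsupp.indicator A fun _ _ => 1
  have ha : ∀ i, a i = if i ∈ A then 1 else 0 := fun i => by simp [a, Finsupp.indicator_apply]
  refine ⟨hprime, Ideal.Quotient.mk _ (monomial a (1 : K)), ?_⟩
  have hmem : ∀ f : MvPolynomial (Fin n) K,
      f ∈ Submodule.colon (⊥ : Submodule (MvPolynomial (Fin n) K) _)
        {Ideal.Quotient.mk (alexanderDual K H ^ 2) (monomial a (1 : K))} ↔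
      f * monomial a 1 ∈ alexanderDual K H ^ 2 := fun f => by
    rw [Submodule.mem_colon_singleton, Submodule.mem_bot, Algebra.smul_def,
      Ideal.Quotient.algebraMap_eq, ← map_mul, Ideal.Quotient.eq_zero_iff_mem]
  suffices h : Ideal.span (X '' W) = Submodule.colon
      (⊥ : Submodule (MvPolynomial (Fin n) K) _)
        {Ideal.Quotient.mk (alexanderDual K H ^ 2) (monomial a (1 : K))} by
    rw [← h, hprime.radical]
  refine le_antisymm (Ideal.span_le.2 ?_) fun f hf => ?_
  · rintro _ ⟨w, hw, rfl⟩
    rw [SetLike.mem_coe, hmem, X, monomial_mul, one_mul, mem_alexanderDual_sq_iff]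
    intro u hu
    obtain rfl : u = Finsupp.single w 1 + a := by simpa using support_monomial_subset hu
    obtain ⟨C, hCA, hC, hD⟩ := hcover w hw
    refine ⟨Finsupp.indicator C fun _ _ => 1,
      (Finsupp.indicator (A \ C) fun _ _ => 1) + Finsupp.single w 1, ?_, ?_, fun i => ?_⟩
    · intro e he
      obtain ⟨i, hi, hiC⟩ := hC e he
      exact ⟨i, hi, by simp [Finsupp.indicator_apply, hiC]⟩
    · intro e he
      obtain ⟨i, hi, hiD⟩ := hD e he
      refine ⟨i, hi, ?_⟩
      rcases hiD with hiD | rfl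
      · simp only [Finsupp.add_apply, Finsupp.indicator_apply, hiD]
        simp
      · simp
    · have hCi : i ∈ C → i ∈ A := fun h => hCA h
      simp only [Finsupp.add_apply, ha, Finsupp.indicator_apply, Finset.mem_sdiff]
      by_cases h1 : i ∈ C <;> by_cases h2 : i ∈ A <;> simp [h1, h2] <;> first | omega | tauto
  · rw [hmem, mem_alexanderDual_sq_iff] at hf
    rw [mem_ideal_span_X_image]
    intro u hu
    by_contra! hu0
    obtain ⟨s, t, hs, ht, hst⟩ := hf (u + a) (by
      rw [mem_support_iff, coeff_mul_monomial, mul_one]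
      exact mem_support_iff.1 hu)
    have hle : ∀ i ∈ W, s i + t i ≤ a i := fun i hi => by
      have := hst i
      rwa [Finsupp.add_apply, Finsupp.add_apply, hu0 i hi, zero_add] at this
    have key : ∀ v : Fin n →₀ ℕ, (∀ i ∈ W, v i ≤ a i) → IsCoverExponent H v →
        ∀ e ∈ H.edgeSet, ∃ i ∈ e, i ∈ A ∧ i ∈ {i | v i ≠ 0} := fun v hv hc e he => by
      obtain ⟨i, hi, h0⟩ := hc e he
      refine ⟨i, hi, ?_, h0⟩
      by_contra hA
      have := hv i (hHW e he hi)
      rw [ha, if_neg hA] at this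
      exact h0 (Nat.le_zero.1 this)
    obtain ⟨i, hiA, hi1, hi2⟩ := hdisj {i | s i ≠ 0} {i | t i ≠ 0}
      (key s (fun i hi => (Nat.le_add_right _ _).trans (hle i hi)) hs)
      (key t (fun i hi => (Nat.le_add_left _ _).trans (hle i hi)) ht)
    have := hle i (hAW hiA)
    rw [ha, if_pos hiA] at this
    simp only [Set.mem_ofPred_eq] at hi1 hi2
    omega

end AlexanderDual

section OddCycle

theorem exists_common_of_odd_cycle {L : ℕ} (hL : Odd L) {c d : ℕ → Prop}
    (hc : ∀ j < L, c j ∨ c ((j + 1) % L)) (hd : ∀ j < L, d j ∨ d ((j + 1) % L)) :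
    ∃ j < L, c j ∧ d j := by
  by_contra! hcd
  have hL0 : 0 < L := hL.pos
  have alt : ∀ j < L, (c j ↔ ¬ c ((j + 1) % L)) := fun j hj => by
    have h1 := hc j hj
    have h2 := hd j hj
    have h3 := hcd j hj
    have h4 := hcd _ (Nat.mod_lt (j + 1) hL0)
    tauto
  have ind : ∀ p < L, (c p ↔ (c 0 ↔ p % 2 = 0)) := by
    intro p
    induction p with
    | zero => simp
    | succ p ih =>
      intro hp
      have h1 := ih (by omega)
      have h2 := alt p (by omega)
      rw [Nat.mod_eq_of_lt hp] at h2
      have h3 : (p + 1) % 2 = 0 ↔ ¬ p % 2 = 0 := by omega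
      tauto
  have h1 := ind (L - 1) (by omega)
  have h2 := alt (L - 1) (by omega)
  rw [Nat.sub_add_cancel hL0, Nat.mod_self] at h2
  have h3 : (L - 1) % 2 = 0 := by
    have := Nat.odd_iff.1 hL
    omega
  tauto

/-- The vertices of the cycle `0, …, L - 1` that are coloured like `j` when the colours alternate
along the cycle except on the edge from `j` to `j + 1`. -/
def cycleColour (L j : ℕ) : Finset ℕ :=
  (Finset.range L).filter fun q => q ≤ j ∧ q % 2 = j % 2 ∨ j < q ∧ q % 2 ≠ j % 2

theorem mem_cycleColour_or {L : ℕ} (hL : Odd L) {j l : ℕ} (hj : j < L) (hl : l < L) :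
    l ∈ cycleColour L j ∨ (l + 1) % L ∈ cycleColour L j := by
  have hodd := Nat.odd_iff.1 hL
  simp only [cycleColour, Finset.mem_filter, Finset.mem_range]
  rcases (Nat.succ_le_iff.2 hl).eq_or_lt with h | h
  · rw [show l + 1 = L from h, Nat.mod_self]
    omega
  · rw [Nat.mod_eq_of_lt h]
    omega

theorem notMem_cycleColour_or {L : ℕ} (hL : Odd L) {j l : ℕ} (hj : j < L) (hl : l < L)
    (hjl : l ≠ j) : l ∉ cycleColour L j ∨ (l + 1) % L ∉ cycleColour L j := by
  have hodd := Nat.odd_iff.1 hL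
  simp only [cycleColour, Finset.mem_filter, Finset.mem_range]
  rcases (Nat.succ_le_iff.2 hl).eq_or_lt with h | h
  · rw [show l + 1 = L from h, Nat.mod_self]
    omega
  · rw [Nat.mod_eq_of_lt h]
    omega

/-- A hypergraph whose edges extend those of an odd cycle by vertices off the cycle. -/
theorem span_X_image_mem_associatedPrimes_of_odd_cycle {K : Type*} [Field K] {n : ℕ}
    {H : Hypergraph (Fin n)} {L h : ℕ} (hL : Odd L) (hLh : L ≤ h) {v : ℕ → Fin n}
    (hv : Set.InjOn v (Finset.range h)) {N : ℕ → Finset ℕ}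
    (hH : H.edgeSet = {e | ∃ j < L, e = v '' N j})
    (hNh : ∀ j < L, N j ⊆ Finset.range h)
    (hN : ∀ j < L, ∀ p < L, p ∈ N j ↔ p = j ∨ p = (j + 1) % L)
    (hcov : ∀ p < h, ∃ j < L, p ∈ N j) {W : Finset (Fin n)} (hW : (Finset.range h).image v = W) :
    Ideal.span (X '' (W : Set (Fin n))) ∈
      associatedPrimes (MvPolynomial (Fin n) K)
        (MvPolynomial (Fin n) K ⧸ alexanderDual K H ^ 2) := by
  have hL0 : 0 < L := hL.pos
  have hinj : ∀ p < h, ∀ q < h, v p = v q → p = q := fun p hp q hq hpq =>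
    hv (by simpa using hp) (by simpa using hq) hpq
  subst hW
  refine span_X_image_mem_associatedPrimes (A := (Finset.range L).image v)
    (Finset.image_subset_image (Finset.range_mono hLh)) ?_ ?_ ?_
  · rw [hH]
    rintro _ ⟨j, hj, rfl⟩
    rw [Finset.coe_image]
    exact Set.image_mono (by exact_mod_cast hNh j hj)
  · intro C D hC hD
    have key : ∀ B : Set (Fin n),
        (∀ e ∈ H.edgeSet, ∃ i ∈ e, i ∈ (Finset.range L).image v ∧ i ∈ B) →
        ∀ j < L, v j ∈ B ∨ v ((j + 1) % L) ∈ B := fun B hB j hj => by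
      obtain ⟨_, ⟨p, hp, rfl⟩, hpA, hpB⟩ := hB (v '' N j) (hH ▸ ⟨j, hj, rfl⟩)
      obtain ⟨q, hq, hqp⟩ := Finset.mem_image.1 hpA
      rw [Finset.mem_range] at hq
      obtain rfl := hinj q (hq.trans_le hLh) p (Finset.mem_range.1 (hNh j hj hp)) hqp
      rcases (hN j hj q hq).1 hp with rfl | rfl
      · exact Or.inl hpB
      · exact Or.inr hpB
    obtain ⟨j, hj, hjC, hjD⟩ := exists_common_of_odd_cycle hL (key C hC) (key D hD)
    exact ⟨v j, Finset.mem_image_of_mem v (Finset.mem_range.2 hj), hjC, hjD⟩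
  · intro w hw
    obtain ⟨p, hp, rfl⟩ := Finset.mem_image.1 hw
    obtain ⟨j, hj, hpj⟩ := hcov p (Finset.mem_range.1 hp)
    have hN1 : ∀ l < L, l ∈ N l := fun l hl => (hN l hl l hl).2 (Or.inl rfl)
    have hN2 : ∀ l < L, (l + 1) % L ∈ N l := fun l hl =>
      (hN l hl _ (Nat.mod_lt _ hL0)).2 (Or.inr rfl)
    have hdiff : ∀ q < L, q ∉ cycleColour L j →
        v q ∈ (Finset.range L).image v \ (cycleColour L j).image v := fun q hq hqj => by
      refine Finset.mem_sdiff.2 ⟨Finset.mem_image_of_mem v (Finset.mem_range.2 hq), fun hmem => ?_⟩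
      obtain ⟨r, hr, hrq⟩ := Finset.mem_image.1 hmem
      have hrL : r < L := Finset.mem_range.1 (Finset.mem_filter.1 hr).1
      exact hqj (hinj r (hrL.trans_le hLh) q (hq.trans_le hLh) hrq ▸ hr)
    refine ⟨(cycleColour L j).image v,
      Finset.image_subset_image (Finset.filter_subset _ _), ?_, ?_⟩
    · rw [hH]
      rintro _ ⟨l, hl, rfl⟩
      rcases mem_cycleColour_or hL hj hl with hc | hc
      · exact ⟨v l, ⟨l, hN1 l hl, rfl⟩, Finset.mem_image_of_mem v hc⟩
      · exact ⟨_, ⟨_, hN2 l hl, rfl⟩, Finset.mem_image_of_mem v hc⟩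
    · rw [hH]
      rintro _ ⟨l, hl, rfl⟩
      by_cases hjl : l = j
      · subst hjl
        exact ⟨v p, ⟨p, hpj, rfl⟩, Or.inr rfl⟩
      · rcases notMem_cycleColour_or hL hj hl hjl with hc | hc
        · exact ⟨v l, ⟨l, hN1 l hl, rfl⟩, Or.inl (hdiff l hl hc)⟩
        · exact ⟨_, ⟨_, hN2 l hl, rfl⟩, Or.inl (hdiff _ (Nat.mod_lt _ hL0) hc)⟩

/-- The `j`-th edge of a hypergraph on `{0, …, h - 1}` whose edges extend those of the cycle
`0, …, L - 1` by `k` further vertices. -/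
def extendedCycleEdge (L k h j : ℕ) : Finset ℕ :=
  {j, (j + 1) % L} ∪ if j = 0 then Finset.Ico L (L + k) else Finset.Ico (h - k) h

theorem card_extendedCycleEdge {L k h j : ℕ} (hL : 1 < L) (hkh : L + k ≤ h) (hj : j < L) :
    (extendedCycleEdge L k h j).card = k + 2 := by
  have hmod := Nat.mod_lt (j + 1) (Nat.zero_lt_of_lt hL)
  have hne : j ≠ (j + 1) % L := by
    rcases (Nat.succ_le_iff.2 hj).eq_or_lt with h1 | h1
    · rw [show j + 1 = L from h1, Nat.mod_self]
      omega
    · rw [Nat.mod_eq_of_lt h1]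
      omega
  rw [extendedCycleEdge, Finset.card_union_of_disjoint, Finset.card_pair hne]
  · split_ifs <;> simp <;> omega
  · rw [Finset.disjoint_left]
    intro p hp
    simp only [Finset.mem_insert, Finset.mem_singleton] at hp
    split_ifs <;> simp only [Finset.mem_Ico] <;> omega

theorem exists_hypergraph_of_lt_card {K : Type*} [Field K] {n m : ℕ} (hm : 3 ≤ m)
    {W : Finset (Fin n)} (hW : m < W.card) :
    ∃ H : Hypergraph (Fin n), IsMHypergraph m H ∧ Ideal.span (X '' (W : Set (Fin n))) ∈
      associatedPrimes (MvPolynomial (Fin n) K)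
        (MvPolynomial (Fin n) K ⧸ alexanderDual K H ^ 2) := by
  obtain ⟨k, rfl⟩ : ∃ k, m = k + 2 := ⟨m - 2, by omega⟩
  obtain ⟨L, hL, hL3, hLk, hLk'⟩ :
      ∃ L, Odd L ∧ 3 ≤ L ∧ L + k ≤ W.card ∧ W.card ≤ L + 1 + k := by
    rcases Nat.even_or_odd (W.card - k) with he | ho
    · refine ⟨W.card - k - 1, Nat.Even.sub_odd (by omega) he odd_one, ?_, by omega, by omega⟩
      obtain ⟨r, hr⟩ := he
      omega
    · exact ⟨W.card - k, ho, by omega, by omega, by omega⟩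
  obtain ⟨v, hv, hvW⟩ : ∃ v : ℕ → Fin n, Set.InjOn v (Finset.range W.card) ∧
      (Finset.range W.card).image v = W := by
    have w₀ : Fin n := (Finset.card_pos.1 (by omega : 0 < W.card)).choose
    let v : ℕ → Fin n := fun p => if hp : p < W.card then W.equivFin.symm ⟨p, hp⟩ else w₀
    have hv : ∀ p (hp : p < W.card), v p = W.equivFin.symm ⟨p, hp⟩ := fun p hp => dif_pos hp
    have hinj : Set.InjOn v (Finset.range W.card) := by
      intro p hp q hq hpq
      have hp' : p < W.card := by simpa using hp
      have hq' : q < W.card := by simpa using hq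
      rw [hv p hp', hv q hq'] at hpq
      simpa using W.equivFin.symm.injective (Subtype.ext hpq)
    refine ⟨v, hinj, Finset.eq_of_subset_of_card_le ?_ ?_⟩
    · intro i hi
      obtain ⟨p, hp, rfl⟩ := Finset.mem_image.1 hi
      rw [hv p (Finset.mem_range.1 hp)]
      exact Subtype.coe_prop _
    · rw [Finset.card_image_of_injOn hinj, Finset.card_range]
  have hsub : ∀ j < L, extendedCycleEdge L k W.card j ⊆ Finset.range W.card := by
    intro j hj p hp
    have hmod := Nat.mod_lt (j + 1) (by omega : 0 < L)
    simp only [extendedCycleEdge, Finset.mem_union, Finset.mem_insert, Finset.mem_singleton] at hp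
    split_ifs at hp <;> simp only [Finset.mem_Ico, Finset.mem_range] at hp ⊢ <;> omega
  refine ⟨⟨Set.univ, {e | ∃ j < L, e = v '' extendedCycleEdge L k W.card j},
    fun _ _ => Set.subset_univ _⟩, ⟨rfl, ?_⟩, ?_⟩
  · rintro _ ⟨j, hj, rfl⟩
    rw [Set.InjOn.ncard_image (hv.mono (by exact_mod_cast hsub j hj)), Set.ncard_coe_finset,
      card_extendedCycleEdge (by omega) hLk hj]
  · refine span_X_image_mem_associatedPrimes_of_odd_cycle hL
      ((Nat.le_add_right L k).trans hLk) hv rfl hsub ?_ ?_ hvW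
    · intro j hj p hp
      simp only [extendedCycleEdge, Finset.mem_union, Finset.mem_insert, Finset.mem_singleton]
      split_ifs <;> simp only [Finset.mem_Ico] <;> omega
    · intro p hp
      by_cases hpL : p < L
      · exact ⟨p, hpL, by simp [extendedCycleEdge]⟩
      by_cases hpk : p < L + k
      · exact ⟨0, by omega, by simp [extendedCycleEdge]; omega⟩
      · exact ⟨1, by omega, by simp [extendedCycleEdge]; omega⟩

theorem exists_hypergraph_of_card_eq {K : Type*} [Field K] {n m : ℕ} (hm : 0 < m)
    {W : Finset (Fin n)} (hW : m = W.card) :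
    ∃ H : Hypergraph (Fin n), IsMHypergraph m H ∧ Ideal.span (X '' (W : Set (Fin n))) ∈
      associatedPrimes (MvPolynomial (Fin n) K)
        (MvPolynomial (Fin n) K ⧸ alexanderDual K H ^ 2) := by
  obtain ⟨a, ha⟩ := Finset.card_pos.1 (hW ▸ hm)
  refine ⟨⟨Set.univ, {(W : Set (Fin n))}, fun _ _ => Set.subset_univ _⟩, ⟨rfl, ?_⟩, ?_⟩
  · rintro _ rfl
    rw [Set.ncard_coe_finset, hW]
  · refine span_X_image_mem_associatedPrimes (A := {a}) (by simpa using ha) ?_ ?_ ?_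
    · rintro _ rfl
      exact subset_rfl
    · intro C D hC hD
      obtain ⟨i, -, hi, hiC⟩ := hC _ rfl
      obtain ⟨j, -, hj, hjD⟩ := hD _ rfl
      rw [Finset.mem_singleton] at hi hj
      subst hi hj
      exact ⟨_, Finset.mem_singleton_self _, hiC, hjD⟩
    · intro w hw
      refine ⟨{a}, subset_rfl, ?_, ?_⟩
      · rintro _ rfl
        exact ⟨a, ha, Finset.mem_singleton_self a⟩
      · rintro _ rfl
        exact ⟨w, hw, Or.inr rfl⟩

end OddCycle

theorem mainTheorem1 (K : Type*) [Field K] (n m : ℕ) (hm : 3 ≤ m) (hmn : m ≤ n)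
    (P : Ideal (MvPolynomial (Fin n) K)) (hP : IsMonomialPrime P) :
    (∃ H : Hypergraph (Fin n), IsMHypergraph m H ∧
        P ∈ associatedPrimes (MvPolynomial (Fin n) K)
          (MvPolynomial (Fin n) K ⧸ (alexanderDual K H) ^ 2)) ↔
      (m : ℕ∞) ≤ P.height := by
  classical
  obtain ⟨hprime, S, hS⟩ := hP
  constructor
  · rintro ⟨H, ⟨-, hH⟩, hass⟩
    obtain ⟨e, he, heP⟩ :=
      exists_edge_of_alexanderDual_le hprime (alexanderDual_le_of_mem_associatedPrimes hass)
    have hcard := card_le_height_span_X_image (K := K) e.toFinset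
    rw [← Set.ncard_eq_toFinset_card', hH e he, Set.coe_toFinset] at hcard
    exact hcard.trans (Ideal.height_mono heP)
  · intro hheight
    let W : Finset (Fin n) := Finset.univ.filter fun i => X i ∈ P
    have hPW : P = Ideal.span (X '' (W : Set (Fin n))) := by
      simpa [W] using eq_span_X_image_of_eq_span_monomial hprime hS
    have hle : m ≤ W.card := by
      have := hheight.trans (hPW ▸ height_span_X_image_le (K := K) W)
      exact_mod_cast this
    rw [hPW]
    rcases hle.eq_or_lt with h | h
    · exact exists_hypergraph_of_card_eq (by omega) h
    · exact exists_hypergraph_of_lt_card hm h
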